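/- Conventions. A Gelfand–Tsetlin triangle of size $n$ is an array $(x_{i,j})_{n\ge i\ge j\ge 1}$ of positive integers ($i$ is the row) with $x_{i+1,j}\le x_{i,j}\le x_{i+1,j+1}$ for $1\le j\le i\le n-1$. It is a Gog triangle if $x_{i,j}<x_{i,j+1}$ for $j<i\le n-1$ and $x_{n,j}=j$ for all $j$; it is a Magog triangle if $x_{i,i}\le i$ for all $i$. For $k\le n$, an $(n,k)$ Gog (resp. Magog) trapezoid is a Gog (resp. Magog) triangle of size $n$ with $x_{i,j}=j$ (resp. $x_{i,j}=1$) whenever $i-j\ge k$. A Gog triangle $X$ of size $n$ corresponds to an alternating sign matrix $M$ of size $n$ if, for every $1\le i\le n$, the entries of row $i$ of $X$ are the columns in which the sum of the last $i$ rows of $M$ equals $1$. For $1\le k\le n-1$, $s_k$ changes only row $k$ of a triangle, replacing $x_{k,j}$ by $\max(x_{k+1,j},x_{k-1,j-1})+\min(x_{k+1,j+1},x_{k-1,j})-x_{k,j}$ (undefined entries are omitted). Let $\omega_j=s_js_{j-1}\cdots s_1$, and let $S=\omega_1\omega_2\cdots\omega_{n-1}$ be the Schützenberger involution. An $(n,k)$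 GOGAm trapezoid is a Gelfand–Tsetlin triangle $Y$ of size $n$ such that $SY$ is a Magog triangle and $Y_{i,j}=1$ whenever $i-j\ge k$. The algorithm. Let $X$ be an $(n,2)$ Gog trapezoid. Put $a_k=X_{n-k,n-k}$ and $b_k=X_{n-k+1,n-k}$ for $1\le k\le n-1$. For $1\le k\le n$ a triangle $X^{(k)}$ of size $k$ is defined: from top to bottom, its rightmost NW–SE diagonal is $u_0,\dots,u_{k-1}$, the next one is $v_1,\dots,v_{k-1}$, and all its other entries are $n-k+1$. Start with $X^{(1)}=(n)$, i.e. $u_0=n$. For $1\le k\le n-1$ put $u_k=a_k$, $v_k=b_k$; then $X^{(k+1)}$ has diagonals $u'_0,\dots,u'_k$ and $v'_1,\dots,v'_k$ (its other entries being $n-k$), where always $u'_k=u_k$ and: * (i) if $v_k=u_k=n-k$: $u'_i=u_i-1$, $v'_i=v_i-1$ for $i\le k-1$, and $v'_k=n-k$; * (ii) if $v_k=n-k<u_k$: $u'_i=u_i$, $v'_i=v_i-1$ for $i\le k-1$, and $v'_k=n-k$; * (iii) if $n-k<v_k=u_k$: $u'_i=u_i-1$ for $i\le k-1$; moreover $v'_i=v_i$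 for all $i\le k$ if the resulting triangle is Gelfand–Tsetlin, and otherwise $v'_i=v_i-1$ for $i\le k-1$ and $v'_k=n-k$; * (iv) if $n-k<v_k<u_k$: $u'_i=u_i$ for all $i$; moreover $v'_i=v_i$ for all $i$ if $v_k\le v_{k-1}$, and otherwise, with $l=\max\{i\le k-1 : v_{k-i}\le v_k-i\}$, $v'_i=n-k$ for $k-l<i\le k$, $v'_{k-l}=v_k-l$, and $v'_i=v_i$ for $i<k-l$. Let $Y=X^{(n)}$ and $T=SY$; $T$ is the Magog trapezoid associated with $X$. Theorem. (a) Let $X$ be a Gog triangle of size $n\ge 1$. There is an alternating sign matrix corresponding to $X$, and in the bottom row of every such matrix the entry in column $X_{1,1}$ is $1$ and all other entries are $0$. (b) Let $X$ be an $(n,2)$ Gog trapezoid ($n\ge2$). Then $Y$ is an $(n,2)$ GOGAm trapezoid with $Y_{1,1}=X_{1,1}$, $T$ is an $(n,2)$ Magog trapezoid, and $$X_{1,1}=\sum_{i=1}^{n}T_{n,i}-\sum_{i=1}^{n-1}T_{n-1,i}.$$ -/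

import Mathlib

/-- The entries `X i j`, `1 ≤ j ≤ i ≤ n`, form a Gelfand-Tsetlin triangle of size `n`.
Triangular arrays are functions `ℕ → ℕ → ℤ` (row index first, indices starting at `1`);
the values outside the triangle are irrelevant. -/
def IsGelfandTsetlin (n : ℕ) (X : ℕ → ℕ → ℤ) : Prop :=
  (∀ i j, 1 ≤ j → j ≤ i → i ≤ n → 1 ≤ X i j) ∧
  (∀ i j, 1 ≤ j → j ≤ i → i + 1 ≤ n → X (i + 1) j ≤ X i j ∧ X i j ≤ X (i + 1) (j + 1))

/-- Gog triangles of size `n`. -/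
def IsGog (n : ℕ) (X : ℕ → ℕ → ℤ) : Prop :=
  IsGelfandTsetlin n X ∧
  (∀ i j, 1 ≤ j → j < i → i + 1 ≤ n → X i j < X i (j + 1)) ∧
  (∀ j, 1 ≤ j → j ≤ n → X n j = j)

/-- `(n, k)` Gog trapezoids. -/
def IsGogTrapezoid (n k : ℕ) (X : ℕ → ℕ → ℤ) : Prop :=
  k ≤ n ∧ IsGog n X ∧ ∀ i j, 1 ≤ j → j + k ≤ i → i ≤ n → X i j = j

/-- Magog triangles of size `n`. -/
def IsMagog (n : ℕ) (X : ℕ → ℕ → ℤ) : Prop :=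
  IsGelfandTsetlin n X ∧ ∀ i, 1 ≤ i → i ≤ n → X i i ≤ i

/-- `(n, k)` Magog trapezoids. -/
def IsMagogTrapezoid (n k : ℕ) (X : ℕ → ℕ → ℤ) : Prop :=
  k ≤ n ∧ IsMagog n X ∧ ∀ i j, 1 ≤ j → j + k ≤ i → i ≤ n → X i j = 1

/-- Alternating sign matrices: entries in `{-1, 0, 1}`, every row and every column has sum `1`,
and consecutive non-zero entries of a row or of a column have opposite signs. -/
def IsAlternatingSignMatrix {n : ℕ} (M : Matrix (Fin n) (Fin n) ℤ) : Prop :=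
  (∀ i j, M i j = -1 ∨ M i j = 0 ∨ M i j = 1) ∧
  (∀ i, ∑ j, M i j = 1) ∧
  (∀ j, ∑ i, M i j = 1) ∧
  (∀ i j j', j < j' → M i j ≠ 0 → M i j' ≠ 0 → (∀ l, j < l → l < j' → M i l = 0) →
    M i j' = -M i j) ∧
  (∀ j i i', i < i' → M i j ≠ 0 → M i' j ≠ 0 → (∀ l, i < l → l < i' → M l j = 0) →
    M i' j = -M i j)

/-- `X` is the Gog triangle of the matrix `M`: row `i` of `X` lists the columns in which the sum of
the last `i` rows of `M` is `1`. Rows and columns of `M` are numbered from `0` here, so the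
row `r` of `M` is at height `n - r` from the bottom and the column `c` has position `c + 1`. -/
def IsGogTriangleOf {n : ℕ} (M : Matrix (Fin n) (Fin n) ℤ) (X : ℕ → ℕ → ℤ) : Prop :=
  ∀ r c : Fin n, (∑ k ∈ Finset.Ici r, M k c = 1) ↔
    ∃ j : ℕ, 1 ≤ j ∧ j ≤ n - (r : ℕ) ∧ X (n - (r : ℕ)) j = (c : ℕ) + 1

/-- The operator `s_k`: every entry of row `k` is reflected in the smallest interval given by its
(at most four) neighbours. For `1 ≤ j ≤ k` the entry `X (k - 1) (j - 1)` is undefined exactly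
for `j = 1`, and `X (k - 1) j` is undefined exactly for `j = k`. -/
def rowReflection (k : ℕ) (X : ℕ → ℕ → ℤ) : ℕ → ℕ → ℤ := fun i j =>
  if i = k then
    (if j ≤ 1 then X (k + 1) j else max (X (k + 1) j) (X (k - 1) (j - 1))) +
      (if k ≤ j then X (k + 1) (j + 1) else min (X (k + 1) (j + 1)) (X (k - 1) j)) - X k j
  else X i j

/-- `ω_j = s_j s_{j-1} ⋯ s_2 s_1`. -/
def omegaOp : ℕ → (ℕ → ℕ → ℤ) → (ℕ → ℕ → ℤ)
  | 0, X => X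
  | j + 1, X => rowReflection (j + 1) (omegaOp j X)

/-- `ω_1 ω_2 ⋯ ω_m` (the operator `ω_m` acts first). -/
def omegaProd : ℕ → (ℕ → ℕ → ℤ) → (ℕ → ℕ → ℤ)
  | 0, X => X
  | m + 1, X => omegaProd m (omegaOp (m + 1) X)

/-- The Schützenberger involution on Gelfand-Tsetlin triangles of size `n`. -/
def schutzenberger (n : ℕ) (X : ℕ → ℕ → ℤ) : ℕ → ℕ → ℤ := omegaProd (n - 1) X

/-- `(n, k)` GOGAm trapezoids: Gelfand-Tsetlin triangles whose Schützenberger image is Magog and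
whose entries with `i - j ≥ k` are `1`. -/
def IsGOGAmTrapezoid (n k : ℕ) (X : ℕ → ℕ → ℤ) : Prop :=
  k ≤ n ∧ IsGelfandTsetlin n X ∧ IsMagog n (schutzenberger n X) ∧
    ∀ i j, 1 ≤ j → j + k ≤ i → i ≤ n → X i j = 1

/-- The triangle of size `m` whose rightmost NW-SE diagonal is, from top to bottom,
`u 0, …, u (m - 1)`, whose next diagonal is `v 1, …, v (m - 1)`, and whose other entries are `c`. -/
def triangleOf (m : ℕ) (c : ℤ) (u v : ℕ → ℤ) : ℕ → ℕ → ℤ := fun i j =>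
  if i = j then u (m - i) else if i = j + 1 then v (m - j) else c

open Classical in
/-- One step of the algorithm for an `(n, 2)` Gog trapezoid, `1 ≤ k ≤ n - 1`. The pair
`(u_i)_{0 ≤ i < k}`, `(v_i)_{1 ≤ i < k}` describes the triangle `X^{(k)}` of size `k`
(all its other entries are `n - k + 1`); the added diagonal is
`n - k, …, n - k, b, a`, and the result describes the triangle `X^{(k+1)}` of size `k + 1`
(all its other entries are `n - k`). -/
noncomputable def gogStep (n k : ℕ) (a b : ℤ) (p : (ℕ → ℤ) × (ℕ → ℤ)) : (ℕ → ℤ) × (ℕ → ℤ) :=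
  let c : ℤ := (n : ℤ) - k
  -- the triangle with the new diagonal added
  let u : ℕ → ℤ := fun i => if i = k then a else p.1 i
  let v : ℕ → ℤ := fun i => if i = k then b else p.2 i
  -- the same, with `1` subtracted from all old entries of one of the diagonals
  let uSub : ℕ → ℤ := fun i => if i = k then a else p.1 i - 1
  let vSub : ℕ → ℤ := fun i => if i = k then c else p.2 i - 1
  if b = c ∧ a = c then (uSub, vSub)
  else if b = c then (u, vSub)
  else if b = a then
    if IsGelfandTsetlin (k + 1) (triangleOf (k + 1) c uSub v) then (uSub, v)
    else (uSub, vSub)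
  else if b ≤ v (k - 1) then (u, v)
  else
    -- the largest `i ≤ k - 1` with `v_{k-i} ≤ v_k - i`
    let l : ℕ := Nat.findGreatest (fun i => v (k - i) ≤ v k - i) (k - 1)
    (u, fun i => if k - l < i then c else if i = k - l then v k - l else v i)

/-- `gogState n X m` describes the triangle `X^{(m+1)}` produced by the algorithm from the
`m + 1` rightmost NW-SE diagonals of the `(n, 2)` Gog trapezoid `X`. -/
noncomputable def gogState (n : ℕ) (X : ℕ → ℕ → ℤ) : ℕ → (ℕ → ℤ) × (ℕ → ℤ)
  | 0 => (fun _ => (n : ℤ), fun _ => 0)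
  | m + 1 => gogStep n (m + 1) (X (n - (m + 1)) (n - (m + 1)))
      (X (n - (m + 1) + 1) (n - (m + 1))) (gogState n X m)

/-- The GOGAm triangle obtained from the `(n, 2)` Gog trapezoid `X`. -/
noncomputable def gogToGOGAm (n : ℕ) (X : ℕ → ℕ → ℤ) : ℕ → ℕ → ℤ :=
  triangleOf n 1 (gogState n X (n - 1)).1 (gogState n X (n - 1)).2

/-- The `(n, 2)` Magog trapezoid associated with the `(n, 2)` Gog trapezoid `X`. -/
noncomputable def gogToMagog (n : ℕ) (X : ℕ → ℕ → ℤ) : ℕ → ℕ → ℤ :=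
  schutzenberger n (gogToGOGAm n X)

/-! Part (a). Let N(i, c) be the number of entries at most c in row i of X. Interlacing says that N
grows by 0 or 1 from one row to the next, strictness of the rows that it grows by 0 or 1 in c. The
mixed second difference of N is therefore an alternating sign matrix, because increments of a 0-1
sequence alternate in sign. In any matrix of X, the bottom row has its only 1 in column X(1,1); the
other entries are nonpositive and sum to 0.

Part (b). Two facts about the Schützenberger involution S carry the proof. The factor ω_{n-1}, which
acts first, moves the first weight Y(1,1) to the last place, and the later factors leave rows n-1
and n alone; this gives the sum formula once Y(1,1) = X(1,1), which holds since the algorithm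
appends u_k = a_k unchanged. For a triangle with two nontrivial diagonals, A_k = Y(k,k) and B_k =
Y(k,k-1) with B_1 = 1, the inequalities `ExcessBounded` pass from size n+1 to size n under ω_n
(`ExcessBounded.of_recurrence`). They bound the top right corner at every stage, and these corners
are the T(i,i).

It remains to see that the algorithm produces such a triangle. The same inequalities, read along u
and v, are part of `GogStateInvariant`, which each step preserves; the lower bound `v_large`
controls the sliding insertion in case (iv). -/

/-! ### Gog triangles and alternating sign matrices -/

theorem sum_Ici_sub_succ {n : ℕ} (F : ℕ → ℤ) (r : Fin n) :
    ∑ k ∈ Finset.Ici r, (F k - F (k + 1)) = F r - F n := by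
  have h := Finset.sum_map (Finset.Ici r) Fin.valEmbedding (fun k => F k - F (k + 1))
  rw [Fin.map_valEmbedding_Ici] at h
  simp only [Fin.valEmbedding_apply] at h
  rw [← h, Finset.sum_Ico_eq_sum_range,
    Finset.sum_congr rfl fun i _ => by rw [add_assoc],
    Finset.sum_range_sub' (fun i => F (r + i))]
  simp [Nat.add_sub_cancel' r.2.le]

/-- Consecutive non-zero increments of a `0`-`1` sequence have opposite signs. -/
theorem increments_alternate {g : ℕ → ℤ} {a b : ℕ} (hab : a < b)
    (hg : ∀ i, i ≤ b + 1 → g i = 0 ∨ g i = 1) (ha : g (a + 1) - g a ≠ 0)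
    (hb : g (b + 1) - g b ≠ 0) (h : ∀ l, a < l → l < b → g (l + 1) - g l = 0) :
    g (b + 1) - g b = -(g (a + 1) - g a) := by
  have key : ∀ l, a + 1 ≤ l → l ≤ b → g l = g (a + 1) := by
    intro l hl
    induction l, hl using Nat.le_induction with
    | base => intro _; rfl
    | succ l hl ih =>
      intro hlb
      have := h l (by omega) (by omega)
      have := ih (by omega)
      omega
  have := key b hab le_rfl
  have := hg a (by omega)
  have := hg (a + 1) (by omega)
  have := hg b (by omega)
  have := hg (b + 1) le_rfl
  omega

/-- The number of entries at most `c` in row `i` of a triangle. -/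
def rowCount (X : ℕ → ℕ → ℤ) (i c : ℕ) : ℕ := (Finset.card {j ∈ Finset.Icc 1 i | X i j ≤ c})

theorem IsGelfandTsetlin.rowCount_le_succ {n i : ℕ} {X : ℕ → ℕ → ℤ} (h : IsGelfandTsetlin n X)
    (hi : i + 1 ≤ n) (c : ℕ) : rowCount X i c ≤ rowCount X (i + 1) c := by
  refine Finset.card_le_card fun j hj => ?_
  simp only [Finset.mem_filter, Finset.mem_Icc] at hj ⊢
  exact ⟨by omega, (h.2 i j hj.1.1 hj.1.2 hi).1.trans hj.2⟩

theorem IsGelfandTsetlin.rowCount_succ_le {n i : ℕ} {X : ℕ → ℕ → ℤ} (h : IsGelfandTsetlin n X)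
    (hi : i + 1 ≤ n) (c : ℕ) : rowCount X (i + 1) c ≤ rowCount X i c + 1 := by
  have hsub : ({j ∈ Finset.Icc 1 (i + 1) | X (i + 1) j ≤ c} : Finset ℕ) ⊆
      insert 1 (({j ∈ Finset.Icc 1 i | X i j ≤ c} : Finset ℕ).image (· + 1)) := by
    intro j hj
    simp only [Finset.mem_filter, Finset.mem_Icc, Finset.mem_insert, Finset.mem_image] at hj ⊢
    by_cases h1 : j = 1
    · exact Or.inl h1
    · refine Or.inr ⟨j - 1, ⟨by omega, ?_⟩, by omega⟩
      have := (h.2 i (j - 1) (by omega) (by omega) hi).2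
      rw [show j - 1 + 1 = j by omega] at this
      exact this.trans hj.2
  exact (Finset.card_le_card hsub).trans
    ((Finset.card_insert_le _ _).trans (Nat.add_le_add_right Finset.card_image_le 1))

theorem IsGog.strict {n : ℕ} {X : ℕ → ℕ → ℤ} (h : IsGog n X) {i j : ℕ} (hj : 1 ≤ j) (hji : j < i)
    (hi : i ≤ n) : X i j < X i (j + 1) := by
  obtain rfl | hlt := Nat.eq_or_lt_of_le hi
  · rw [h.2.2 j hj hji.le, h.2.2 (j + 1) (by omega) hji]
    push_cast
    omega
  · exact h.2.1 i j hj hji hlt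

theorem IsGog.strictMono {n : ℕ} {X : ℕ → ℕ → ℤ} (h : IsGog n X) {i j k : ℕ} (hj : 1 ≤ j)
    (hjk : j < k) (hki : k ≤ i) (hi : i ≤ n) : X i j < X i k := by
  induction k, Nat.succ_le_of_lt hjk using Nat.le_induction with
  | base => exact h.strict hj (by omega) hi
  | succ k hk ih => exact (ih (by omega) (by omega)).trans (h.strict (by omega) (by omega) hi)

theorem IsGog.le_size {n : ℕ} {X : ℕ → ℕ → ℤ} (h : IsGog n X) {i j : ℕ} (hj : 1 ≤ j) (hji : j ≤ i)
    (hi : i ≤ n) : X i j ≤ n := by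
  have key : ∀ d i j, n = i + d → 1 ≤ j → j ≤ i → X i j ≤ n := by
    intro d
    induction d with
    | zero =>
      rintro i j rfl hj hji
      rw [h.2.2 j hj hji]
      exact_mod_cast hji
    | succ d ih =>
      intro i j hid hj hji
      exact (h.1.2 i j hj hji (by omega)).2.trans (ih (i + 1) (j + 1) (by omega) (by omega)
        (by omega))
  exact key (n - i) i j (by omega) hj hji

theorem IsGog.rowCount_zero {n i : ℕ} {X : ℕ → ℕ → ℤ} (h : IsGog n X) (hi : i ≤ n) :
    rowCount X i 0 = 0 := by
  rw [rowCount, Finset.card_eq_zero, Finset.filter_eq_empty_iff]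
  intro j hj
  rw [Finset.mem_Icc] at hj
  have := h.1.1 i j hj.1 hj.2 hi
  push_cast
  omega

theorem IsGog.rowCount_size {n i : ℕ} {X : ℕ → ℕ → ℤ} (h : IsGog n X) (hi : i ≤ n) :
    rowCount X i n = i := by
  rw [rowCount, Finset.filter_true_of_mem, Nat.card_Icc, Nat.add_sub_cancel]
  intro j hj
  rw [Finset.mem_Icc] at hj
  exact h.le_size hj.1 hj.2 hi

theorem rowCount_succ (X : ℕ → ℕ → ℤ) (i c : ℕ) :
    rowCount X i (c + 1) = rowCount X i c + (Finset.card {j ∈ Finset.Icc 1 i | X i j = c + 1}) := by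
  rw [rowCount, rowCount, ← Finset.card_union_of_disjoint]
  · congr 1
    ext j
    simp only [Finset.mem_filter, Finset.mem_union]
    push_cast
    constructor
    · rintro ⟨h1, h2⟩
      rcases h2.lt_or_eq with h | h
      · exact Or.inl ⟨h1, by omega⟩
      · exact Or.inr ⟨h1, h⟩
    · rintro (⟨h1, h2⟩ | ⟨h1, h2⟩)
      · exact ⟨h1, by omega⟩
      · exact ⟨h1, h2.le⟩
  · rw [Finset.disjoint_filter]
    intros
    omega

/-- The indicator function of the event that `c + 1` is an entry of row `i`, as an increment of
`rowCount`. -/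
def rowIndicator (X : ℕ → ℕ → ℤ) (i c : ℕ) : ℤ := rowCount X i (c + 1) - rowCount X i c

theorem IsGog.rowIndicator_eq {n i : ℕ} {X : ℕ → ℕ → ℤ} (h : IsGog n X) (hi : i ≤ n) (c : ℕ)
    [Decidable (∃ j, 1 ≤ j ∧ j ≤ i ∧ X i j = c + 1)] :
    rowIndicator X i c = if ∃ j, 1 ≤ j ∧ j ≤ i ∧ X i j = c + 1 then 1 else 0 := by
  have e : rowIndicator X i c = ((Finset.card {j ∈ Finset.Icc 1 i | X i j = c + 1}) : ℕ) := by
    rw [rowIndicator, rowCount_succ]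
    push_cast
    ring
  rw [e]
  split_ifs with hex
  · obtain ⟨j, hj1, hj2, hj3⟩ := hex
    have : ({j ∈ Finset.Icc 1 i | X i j = c + 1} : Finset ℕ) = {j} := by
      ext k
      simp only [Finset.mem_filter, Finset.mem_Icc, Finset.mem_singleton]
      constructor
      · rintro ⟨⟨hk1, hk2⟩, hk3⟩
        rcases lt_trichotomy k j with hlt | heq | hlt
        · have := h.strictMono hk1 hlt hj2 hi
          omega
        · exact heq
        · have := h.strictMono hj1 hlt hk2 hi
          omega
      · rintro rfl
        exact ⟨⟨hj1, hj2⟩, hj3⟩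
    rw [this]
    simp
  · rw [Nat.cast_eq_zero, Finset.card_eq_zero, Finset.filter_eq_empty_iff]
    intro j hj hjc
    rw [Finset.mem_Icc] at hj
    exact hex ⟨j, hj.1, hj.2, hjc⟩

theorem IsGog.rowIndicator_zero_or_one {n i : ℕ} {X : ℕ → ℕ → ℤ} (h : IsGog n X) (hi : i ≤ n)
    (c : ℕ) : rowIndicator X i c = 0 ∨ rowIndicator X i c = 1 := by
  classical
  rw [h.rowIndicator_eq hi c]
  split_ifs <;> simp

/-- The alternating sign matrix of a Gog triangle. -/
def gogMatrix (n : ℕ) (X : ℕ → ℕ → ℤ) : Matrix (Fin n) (Fin n) ℤ := fun r c =>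
  rowIndicator X (n - r) c - rowIndicator X (n - (r + 1)) c

theorem sum_Ici_gogMatrix {n : ℕ} {X : ℕ → ℕ → ℤ} (r c : Fin n) :
    ∑ k ∈ Finset.Ici r, gogMatrix n X k c = rowIndicator X (n - r) c := by
  have := sum_Ici_sub_succ (fun k => rowIndicator X (n - k) c) r
  simp only [gogMatrix]
  rw [this]
  -- The boundary term of the telescoping sum belongs to row 0, which is empty.
  simp [rowIndicator, rowCount]

theorem IsGog.isGogTriangleOf_gogMatrix {n : ℕ} {X : ℕ → ℕ → ℤ} (h : IsGog n X) :
    IsGogTriangleOf (gogMatrix n X) X := by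
  classical
  intro r c
  rw [sum_Ici_gogMatrix, h.rowIndicator_eq (by omega)]
  simp

theorem IsGog.isAlternatingSignMatrix_gogMatrix {n : ℕ} {X : ℕ → ℕ → ℤ} (h : IsGog n X) :
    IsAlternatingSignMatrix (gogMatrix n X) := by
  classical
  have row : ∀ r c : Fin n, gogMatrix n X r c =
      ((rowCount X (n - r) (c + 1) : ℤ) - rowCount X (n - (r + 1)) (c + 1)) -
        ((rowCount X (n - r) c : ℤ) - rowCount X (n - (r + 1)) c) := by
    intro r c
    simp only [gogMatrix, rowIndicator]
    ring
  refine ⟨?_, ?_, ?_, ?_, ?_⟩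
  · intro r c
    have h1 := h.rowIndicator_zero_or_one (i := n - r) (by omega) c
    have h2 := h.rowIndicator_zero_or_one (i := n - (r + 1)) (by omega) c
    simp only [gogMatrix]
    omega
  · intro r
    rw [Finset.sum_congr rfl fun c _ => row r c,
      Fin.sum_univ_eq_sum_range (fun c => ((rowCount X (n - r) (c + 1) : ℤ) -
        rowCount X (n - (r + 1)) (c + 1)) -
        ((rowCount X (n - r) c : ℤ) - rowCount X (n - (r + 1)) c)),
      Finset.sum_range_sub (fun c => (rowCount X (n - r) c : ℤ) - rowCount X (n - (r + 1)) c),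
      h.rowCount_zero (by omega), h.rowCount_zero (by omega), h.rowCount_size (by omega),
      h.rowCount_size (by omega)]
    have := r.2
    omega
  · intro c
    have hn : 0 < n := c.pos
    have := sum_Ici_gogMatrix (X := X) (⟨0, hn⟩ : Fin n) c
    have huniv : Finset.Ici (⟨0, hn⟩ : Fin n) = Finset.univ := by
      ext i
      simp [Fin.le_def]
    rw [huniv] at this
    rw [this, h.rowIndicator_eq (by simp), if_pos]
    exact ⟨c + 1, by omega, by simp, by
      simp only [Nat.sub_zero]
      rw [h.2.2 _ (by omega) (by omega)]
      push_cast
      rfl⟩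
  · intro r c c' hcc' h1 h2 h3
    simp only [row] at h1 h2 h3 ⊢
    -- Read along a row, the matrix consists of the increments in `c` of the difference of two
    -- consecutive row counts, a 0-1 sequence by interlacing.
    refine increments_alternate
      (g := fun c => (rowCount X (n - r) c : ℤ) - rowCount X (n - (r + 1)) c) hcc' ?_ h1 h2 ?_
    · intro i _
      have hr := r.2
      have e1 := h.1.rowCount_le_succ (i := n - (r + 1)) (by omega) i
      have e2 := h.1.rowCount_succ_le (i := n - (r + 1)) (by omega) i
      rw [show n - ((r : ℕ) + 1) + 1 = n - r by omega] at e1 e2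
      omega
    · intro l hl hl'
      exact h3 ⟨l, by omega⟩ hl hl'
  · intro c r r' hrr' h1 h2 h3
    simp only [gogMatrix] at h1 h2 h3 ⊢
    have := increments_alternate (g := fun r => rowIndicator X (n - r) c) hrr'
      (fun i _ => h.rowIndicator_zero_or_one (by omega) c)
      (by omega) (by omega) (fun l hl hl' => by
        have := h3 ⟨l, by omega⟩ hl hl'
        simp only at this
        omega)
    omega

theorem IsGogTriangleOf.bottom_row {n : ℕ} {M : Matrix (Fin n) (Fin n) ℤ} {X : ℕ → ℕ → ℤ}
    (hM : IsAlternatingSignMatrix M) (h : IsGogTriangleOf M X) {r : Fin n} (hr : (r : ℕ) + 1 = n)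
    (c : Fin n) : M r c = if X 1 1 = ((c : ℕ) : ℤ) + 1 then 1 else 0 := by
  have hIci : Finset.Ici r = {r} := by
    ext i
    simp only [Finset.mem_Ici, Finset.mem_singleton, Fin.le_def, Fin.ext_iff]
    omega
  have hone : ∀ c : Fin n, M r c = 1 ↔ X 1 1 = ((c : ℕ) : ℤ) + 1 := by
    intro c
    have := h r c
    rw [hIci, Finset.sum_singleton, show n - (r : ℕ) = 1 by omega] at this
    rw [this]
    constructor
    · rintro ⟨j, hj1, hj2, hj3⟩
      obtain rfl : j = 1 := by omega
      exact hj3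
    · exact fun h => ⟨1, le_rfl, le_rfl, h⟩
  have hsum := hM.2.1 r
  obtain ⟨c₀, hc₀⟩ : ∃ c₀, M r c₀ = 1 := by
    by_contra! hne
    have : ∑ j, M r j ≤ 0 := Finset.sum_nonpos fun j _ => by
      have := hM.1 r j
      have := hne j
      omega
    omega
  have hle : ∀ j, j ≠ c₀ → M r j ≤ 0 := by
    intro j hj
    have h1 := hM.1 r j
    by_contra hpos
    have h2 := (hone j).1 (by omega)
    have h3 := (hone c₀).1 hc₀
    exact hj (Fin.ext (by omega))
  -- The row sum is 1 and is already used up by column `c₀`.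
  have hrest : ∑ j ∈ Finset.univ.erase c₀, M r j = 0 := by
    have := Finset.add_sum_erase Finset.univ (M r) (Finset.mem_univ c₀)
    omega
  have hzero := (Finset.sum_eq_zero_iff_of_nonpos
    (fun j hj => hle j (Finset.ne_of_mem_erase hj))).1 hrest
  split_ifs with hX
  · exact (hone c).2 hX
  · refine hzero c (Finset.mem_erase.2 ⟨?_, Finset.mem_univ c⟩)
    rintro rfl
    exact hX ((hone c).1 hc₀)

/-! ### The operators ω on Gelfand-Tsetlin triangles -/

theorem omegaOp_of_lt (X : ℕ → ℕ → ℤ) {j i : ℕ} (h : j < i) : omegaOp j X i = X i := by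
  induction j with
  | zero => rfl
  | succ j ih =>
    funext c
    simp only [omegaOp, rowReflection]
    rw [if_neg (by omega), ih (by omega)]

theorem omegaOp_stable (X : ℕ → ℕ → ℤ) {i j : ℕ} (h : i ≤ j) : omegaOp j X i = omegaOp i X i := by
  induction j, h using Nat.le_induction with
  | base => rfl
  | succ j hij ih =>
    funext c
    rw [← ih]
    simp only [omegaOp, rowReflection]
    rw [if_neg (by omega)]

/-- When row `k + 1` is reflected, the row below it in index has already been changed and row `k +
2` has not. This makes ω a recurrence on rows. -/
theorem omegaOp_apply (X : ℕ → ℕ → ℤ) {k m : ℕ} (h : k + 1 ≤ m) (j : ℕ) :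
    omegaOp m X (k + 1) j =
      (if j ≤ 1 then X (k + 2) j else max (X (k + 2) j) (omegaOp m X k (j - 1))) +
      (if k + 1 ≤ j then X (k + 2) (j + 1) else min (X (k + 2) (j + 1)) (omegaOp m X k j)) -
      X (k + 1) j := by
  rw [omegaOp_stable X h, omegaOp_stable X (show k ≤ m by omega)]
  simp only [omegaOp, rowReflection, if_true, Nat.add_sub_cancel]
  rw [omegaOp_of_lt X (show k < k + 1 + 1 by omega), omegaOp_of_lt X (show k < k + 1 by omega)]

theorem omegaProd_of_lt (X : ℕ → ℕ → ℤ) {m i : ℕ} (h : m < i) : omegaProd m X i = X i := by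
  induction m generalizing X with
  | zero => rfl
  | succ m ih => rw [omegaProd, ih _ (by omega), omegaOp_of_lt X h]

theorem IsGelfandTsetlin.mono {n m : ℕ} {X : ℕ → ℕ → ℤ} (h : IsGelfandTsetlin n X) (hm : m ≤ n) :
    IsGelfandTsetlin m X :=
  ⟨fun i j hj hji hi => h.1 i j hj hji (hi.trans hm),
    fun i j hj hji hi => h.2 i j hj hji (hi.trans hm)⟩

/-- Each entry is reflected in exactly the interval that interlacing allows it, its neighbours in
rows `k - 1` and `k + 1` being fixed. -/
theorem IsGelfandTsetlin.rowReflection {n k : ℕ} {X : ℕ → ℕ → ℤ} (h : IsGelfandTsetlin n X)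
    (hk : 1 ≤ k) (hkn : k + 1 ≤ n) : IsGelfandTsetlin n (rowReflection k X) := by
  have bounds : ∀ j, 1 ≤ j → j ≤ k →
      (if j ≤ 1 then X (k + 1) j else max (X (k + 1) j) (X (k - 1) (j - 1)))
        ≤ _root_.rowReflection k X k j ∧
      _root_.rowReflection k X k j ≤
        (if k ≤ j then X (k + 1) (j + 1) else min (X (k + 1) (j + 1)) (X (k - 1) j)) := by
    intro j hj hjk
    have h1 := h.2 k j hj hjk hkn
    have h2 : 1 < j → X (k - 1) (j - 1) ≤ X k j := by
      intro hj1
      have := (h.2 (k - 1) (j - 1) (by omega) (by omega) (by omega)).2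
      rwa [show k - 1 + 1 = k by omega, show j - 1 + 1 = j by omega] at this
    have h3 : j < k → X k j ≤ X (k - 1) j := by
      intro hj1
      have := (h.2 (k - 1) j (by omega) (by omega) (by omega)).1
      rwa [show k - 1 + 1 = k by omega] at this
    simp only [_root_.rowReflection, if_true]
    split_ifs with c1 c2 c2
    · omega
    · have := h3 (by omega); omega
    · have := h2 (by omega); omega
    · have := h2 (by omega); have := h3 (by omega); omega
  have off : ∀ i j, i ≠ k → _root_.rowReflection k X i j = X i j := by
    intro i j hi
    simp [_root_.rowReflection, hi]
  have low : ∀ j, 1 ≤ j → j ≤ k → X (k + 1) j ≤ _root_.rowReflection k X k j := by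
    intro j hj hjk
    refine le_trans ?_ (bounds j hj hjk).1
    split_ifs
    · exact le_rfl
    · exact le_max_left _ _
  have high : ∀ j, 1 ≤ j → j ≤ k → _root_.rowReflection k X k j ≤ X (k + 1) (j + 1) := by
    intro j hj hjk
    refine le_trans (bounds j hj hjk).2 ?_
    split_ifs
    · exact le_rfl
    · exact min_le_left _ _
  constructor
  · intro i j hj hji hi
    by_cases hik : i = k
    · subst hik
      exact (h.1 _ _ hj (by omega) (by omega)).trans (low j hj hji)
    · rw [off _ _ hik]
      exact h.1 i j hj hji hi
  · intro i j hj hji hi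
    by_cases hik : i = k
    · subst hik
      rw [off (i + 1) _ (by omega), off (i + 1) _ (by omega)]
      exact ⟨low j hj hji, high j hj hji⟩
    · rw [off i _ hik]
      by_cases hik' : i + 1 = k
      · subst hik'
        constructor
        · refine (bounds j hj (by omega)).2.trans ?_
          rw [if_neg (by omega)]
          exact min_le_right _ _
        · refine le_trans ?_ (bounds (j + 1) (by omega) (by omega)).1
          rw [if_neg (by omega)]
          exact le_max_right _ _
      · rw [off _ _ hik', off _ _ hik']
        exact h.2 i j hj hji hi

theorem IsGelfandTsetlin.omegaOp {n m : ℕ} {X : ℕ → ℕ → ℤ} (h : IsGelfandTsetlin n X)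
    (hm : m + 1 ≤ n) : IsGelfandTsetlin n (omegaOp m X) := by
  induction m with
  | zero => exact h
  | succ m ih => exact (ih (by omega)).rowReflection (by omega) hm

theorem IsGelfandTsetlin.omegaProd {n m : ℕ} {X : ℕ → ℕ → ℤ} (h : IsGelfandTsetlin n X)
    (hm : m + 1 ≤ n) : IsGelfandTsetlin n (omegaProd m X) := by
  induction m generalizing X with
  | zero => exact h
  | succ m ih => exact ih (h.omegaOp hm) (by omega)

/-! ### Two-diagonal triangles and the Magog condition -/

/-- All entries outside the two rightmost diagonals are `1`. -/
def HasTwoDiagonals (n : ℕ) (X : ℕ → ℕ → ℤ) : Prop :=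
  ∀ i j, 1 ≤ j → j + 2 ≤ i → i ≤ n → X i j = 1

/-- Outside the two diagonals the interval of reflection collapses to the point 1. -/
theorem HasTwoDiagonals.rowReflection {n k : ℕ} {X : ℕ → ℕ → ℤ} (h : HasTwoDiagonals n X)
    (hX : IsGelfandTsetlin n X) (hkn : k + 1 ≤ n) :
    HasTwoDiagonals n (rowReflection k X) := by
  intro i j hj hji hi
  by_cases hik : i = k
  · subst hik
    simp only [_root_.rowReflection, if_true]
    rw [h i j hj hji hi, h (i + 1) j hj (by omega) hkn,
      h (i + 1) (j + 1) (by omega) (by omega) hkn, if_neg (show ¬ i ≤ j by omega),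
      min_eq_left (hX.1 _ _ hj (by omega) (by omega))]
    by_cases h1 : j ≤ 1
    · rw [if_pos h1]
      rfl
    · rw [if_neg h1, h (i - 1) (j - 1) (by omega) (by omega) (by omega)]
      simp
  · simp only [_root_.rowReflection, if_neg hik]
    exact h i j hj hji hi

theorem HasTwoDiagonals.omegaOp {n m : ℕ} {X : ℕ → ℕ → ℤ} (h : HasTwoDiagonals n X)
    (hX : IsGelfandTsetlin n X) (hm : m + 1 ≤ n) : HasTwoDiagonals n (omegaOp m X) := by
  induction m with
  | zero => exact h
  | succ m ih => exact (ih (by omega)).rowReflection (hX.omegaOp (by omega)) hm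

theorem HasTwoDiagonals.omegaProd {n m : ℕ} {X : ℕ → ℕ → ℤ} (h : HasTwoDiagonals n X)
    (hX : IsGelfandTsetlin n X) (hm : m + 1 ≤ n) : HasTwoDiagonals n (omegaProd m X) := by
  induction m generalizing X with
  | zero => exact h
  | succ m ih => exact ih (h.omegaOp hX hm) (hX.omegaOp hm) (by omega)

/-- The entry `X k (k - 1)` of the second diagonal, with the convention that it is `1` for
`k = 1`. -/
def secondDiagonal (X : ℕ → ℕ → ℤ) (k : ℕ) : ℤ := if k = 1 then 1 else X k (k - 1)

/-- For triangles with two diagonals, the inequalities that say that the image of `X` by the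
Schützenberger involution is a Magog triangle. -/
def ExcessBounded (n : ℕ) (X : ℕ → ℕ → ℤ) : Prop :=
  X n n ≤ n ∧ ∀ m t, 1 ≤ m → m < t → t ≤ n →
    X n n - X (t - 1) (t - 1) + secondDiagonal X t - secondDiagonal X m ≤ (n : ℤ) - m - 1

/-- Put D_k = A'_k - A_{k+1}. The recurrence makes D a running maximum: D_k is the largest B_{s+1} -
A_s with 1 ≤ s ≤ k. Conservation of weight eliminates B', so each new inequality involves only D, A
and B, and follows from an old one by choosing where the maximum D_n is attained. -/
theorem ExcessBounded.of_recurrence {n : ℕ} {A B A' B' : ℕ → ℤ}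
    (hE : ∀ m t, 1 ≤ m → m < t → t ≤ n + 1 → A (n + 1) - A (t - 1) + B t - B m ≤ (n : ℤ) - m)
    (hn : 1 ≤ n) (hB1 : B 1 = 1) (hB'1 : B' 1 = 1) (hA'1 : A' 1 = B 2 + A 2 - A 1)
    (hA' : ∀ k, 1 ≤ k → k + 1 ≤ n → A' (k + 1) = max (B (k + 2)) (A' k) + A (k + 2) - A (k + 1))
    (hB' : ∀ k, 1 ≤ k → k + 1 ≤ n → B' (k + 1) = B' k + min (B (k + 2)) (A' k) - B (k + 1)) :
    A' n ≤ n ∧ ∀ m t, 1 ≤ m → m < t → t ≤ n →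
      A' n - A' (t - 1) + B' t - B' m ≤ (n : ℤ) - m - 1 := by
  have sum_eq : ∀ k, 1 ≤ k → k ≤ n → A' k + B' k = A (k + 1) + B (k + 1) - A 1 + 1 := by
    intro k hk
    induction k, hk using Nat.le_induction with
    | base => intro _; rw [hA'1, hB'1]; ring_nf
    | succ k hk ih =>
      intro hkn
      have := ih (by omega)
      rw [hA' k hk hkn, hB' k hk hkn]
      have := max_add_min (B (k + 2)) (A' k)
      linarith
  have mono : ∀ m k, 1 ≤ m → m ≤ k → k ≤ n → A' m - A (m + 1) ≤ A' k - A (k + 1) := by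
    intro m k hm hmk
    induction k, hmk using Nat.le_induction with
    | base => intro _; rfl
    | succ k hk ih =>
      intro hkn
      refine (ih (by omega)).trans ?_
      rw [hA' k (by omega) hkn]
      have := le_max_right (B (k + 2)) (A' k)
      linarith
  have attained : ∀ m k, 1 ≤ m → m ≤ k → k ≤ n → A' k - A (k + 1) = A' m - A (m + 1) ∨
      ∃ s, m < s ∧ s ≤ k ∧ A' k - A (k + 1) = B (s + 1) - A s := by
    intro m k hm hmk
    induction k, hmk using Nat.le_induction with
    | base => intro _; exact Or.inl rfl
    | succ k hk ih =>
      intro hkn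
      have hk' := hA' k (by omega) hkn
      rcases max_cases (B (k + 2)) (A' k) with ⟨h1, _⟩ | ⟨h1, _⟩
      · exact Or.inr ⟨k + 1, by omega, le_rfl, by rw [hk', h1]; ring_nf⟩
      · have : A' (k + 1) - A (k + 1 + 1) = A' k - A (k + 1) := by rw [hk', h1]; ring_nf
        rcases ih (by omega) with h | ⟨s, hs1, hs2, hs3⟩
        · exact Or.inl (this.trans h)
        · exact Or.inr ⟨s, hs1, by omega, this.trans hs3⟩
  have lower : ∀ t, 1 ≤ t → t ≤ n → B (t + 1) - A t ≤ A' t - A (t + 1) := by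
    intro t ht htn
    obtain rfl | ht' := Nat.eq_or_lt_of_le ht
    · rw [hA'1]; ring_nf; rfl
    · obtain ⟨k, rfl⟩ : ∃ k, t = k + 1 := ⟨t - 1, by omega⟩
      rw [hA' k (by omega) htn]
      have := le_max_left (B (k + 2)) (A' k)
      rw [show k + 1 + 1 = k + 2 by omega]
      linarith
  constructor
  · have : ∃ s, 1 ≤ s ∧ s ≤ n ∧ A' n - A (n + 1) = B (s + 1) - A s := by
      rcases attained 1 n le_rfl hn le_rfl with h | ⟨s, hs1, hs2, hs3⟩
      · exact ⟨1, le_rfl, hn, by rw [h, hA'1]; ring_nf⟩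
      · exact ⟨s, hs1.le, hs2, hs3⟩
    obtain ⟨s, hs1, hs2, hs3⟩ := this
    have := hE 1 (s + 1) le_rfl (by omega) (by omega)
    rw [Nat.add_sub_cancel] at this
    push_cast at this
    linarith
  · intro m t hm hmt htn
    have e1 := sum_eq t (by omega) htn
    have e2 := sum_eq m hm (by omega)
    have m1 := mono m (t - 1) hm (by omega) (by omega)
    have m2 := mono (t - 1) t (by omega) (by omega) htn
    have m3 := mono t n (by omega) htn le_rfl
    have l1 := lower t (by omega) htn
    rw [show t - 1 + 1 = t by omega] at m1 m2
    -- If D_n = D_m, then D is constant on [m, n] and cancels. Otherwise D_n = B_{s+1} - A_s with s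
    -- > m, and D_m ≤ D_{t-1} together with B_{t+1} - A_t ≤ D_t removes `t`.
    rcases attained m n hm (by omega) le_rfl with h | ⟨s, hs1, hs2, hs3⟩
    · have := hE (m + 1) (t + 1) (by omega) (by omega) (by omega)
      rw [Nat.add_sub_cancel] at this
      push_cast at this
      linarith
    · have := hE (m + 1) (s + 1) (by omega) (by omega) (by omega)
      rw [Nat.add_sub_cancel] at this
      push_cast at this
      linarith

theorem ExcessBounded.omegaOp {n : ℕ} {X : ℕ → ℕ → ℤ} (h : ExcessBounded (n + 1) X)
    (hX : IsGelfandTsetlin (n + 1) X) (hD : HasTwoDiagonals (n + 1) X) (hn : 1 ≤ n) :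
    ExcessBounded n (omegaOp n X) := by
  have hGT := hX.omegaOp (le_refl (n + 1))
  refine ExcessBounded.of_recurrence (A := fun k => X k k) (B := secondDiagonal X)
    (A' := fun k => _root_.omegaOp n X k k) (B' := secondDiagonal (_root_.omegaOp n X))
    ?_ hn (by simp [secondDiagonal]) (by simp [secondDiagonal]) ?_ ?_ ?_
  · intro m t hm hmt ht
    have := h.2 m t hm hmt ht
    push_cast at this
    linarith
  · rw [omegaOp_apply X (k := 0) (by omega)]
    simp [secondDiagonal]
  · intro k hk hkn
    rw [omegaOp_apply X hkn, if_neg (by omega), if_pos le_rfl]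
    simp [secondDiagonal]
  · intro k hk hkn
    simp only [secondDiagonal]
    rw [if_neg (show k + 1 ≠ 1 by omega), if_neg (show k + 2 ≠ 1 by omega),
      if_neg (show k + 1 ≠ 1 by omega), Nat.add_sub_cancel, omegaOp_apply X hkn,
      if_neg (show ¬ k + 1 ≤ k by omega), hD (k + 2) k hk le_rfl (by omega),
      show k + 2 - 1 = k + 1 by omega]
    -- For `k = 1` there is no left neighbour in row `k`; the convention B'_1 = 1 supplies its
    -- value.
    by_cases hk1 : k = 1
    · simp [hk1]
    · rw [if_neg (by omega), if_neg hk1, max_eq_right (hGT.1 _ _ (by omega) (by omega) (by omega))]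

/-- After the first factor the last row is final, and the remaining factors act on the triangle of
size one less. -/
theorem ExcessBounded.omegaProd_le {n : ℕ} {X : ℕ → ℕ → ℤ} (h : ExcessBounded (n + 1) X)
    (hX : IsGelfandTsetlin (n + 1) X) (hD : HasTwoDiagonals (n + 1) X) {i : ℕ} (hi : 1 ≤ i)
    (hin : i ≤ n + 1) : omegaProd n X i i ≤ i := by
  induction n generalizing X with
  | zero =>
    obtain rfl : i = 1 := by omega
    exact h.1
  | succ n ih =>
    obtain rfl | hlt := Nat.eq_or_lt_of_le hin
    · rw [omegaProd_of_lt X (by omega)]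
      exact h.1
    · rw [omegaProd]
      refine ih (h.omegaOp hX hD (by omega)) ((hX.omegaOp le_rfl).mono (by omega)) ?_ (by omega)
      intro i j hj hji hi
      exact hD.omegaOp hX le_rfl i j hj hji (by omega)

/-! ### Weights under ω -/

/-- The minimum at `j` and the maximum at `j + 1` involve the same two numbers and add up to their
sum; a partial sum leaves one minimum unpaired. -/
theorem sum_reflection_of_lt (p q r : ℕ → ℤ) {k m : ℕ} (hm : m + 1 < k) :
    ∑ j ∈ Finset.Icc 1 (m + 1), ((if j ≤ 1 then p j else max (p j) (q (j - 1))) +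
      (if k ≤ j then p (j + 1) else min (p (j + 1)) (q j)) - r j) =
    ∑ j ∈ Finset.Icc 1 (m + 1), p j + ∑ j ∈ Finset.Icc 1 m, q j + min (p (m + 2)) (q (m + 1)) -
      ∑ j ∈ Finset.Icc 1 (m + 1), r j := by
  induction m with
  | zero => simp [show ¬ k ≤ 1 by omega]
  | succ m ih =>
    rw [Finset.sum_Icc_succ_top (by omega), ih (by omega),
      Finset.sum_Icc_succ_top (show 1 ≤ m + 1 + 1 by omega) p,
      Finset.sum_Icc_succ_top (show 1 ≤ m + 1 + 1 by omega) r,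
      Finset.sum_Icc_succ_top (show 1 ≤ m + 1 by omega) q, if_neg (by omega), if_neg (by omega)]
    have := max_add_min (p (m + 2)) (q (m + 1))
    simp only [show m + 1 + 1 = m + 2 by omega, show m + 2 + 1 = m + 3 by omega,
      show m + 2 - 1 = m + 1 by omega]
    linarith

theorem sum_reflection (p q r : ℕ → ℤ) (k : ℕ) :
    ∑ j ∈ Finset.Icc 1 (k + 1), ((if j ≤ 1 then p j else max (p j) (q (j - 1))) +
      (if k + 1 ≤ j then p (j + 1) else min (p (j + 1)) (q j)) - r j) =
    ∑ j ∈ Finset.Icc 1 (k + 2), p j + ∑ j ∈ Finset.Icc 1 k, q j -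
      ∑ j ∈ Finset.Icc 1 (k + 1), r j := by
  rcases k with _ | k
  · simp [Finset.sum_Icc_succ_top]
  · rw [Finset.sum_Icc_succ_top (by omega), sum_reflection_of_lt p q r (by omega),
      Finset.sum_Icc_succ_top (show 1 ≤ k + 1 + 2 by omega) p,
      Finset.sum_Icc_succ_top (show 1 ≤ k + 1 + 1 by omega) p,
      Finset.sum_Icc_succ_top (show 1 ≤ k + 1 + 1 by omega) r,
      Finset.sum_Icc_succ_top (show 1 ≤ k + 1 by omega) q, if_neg (by omega), if_pos le_rfl]
    have := max_add_min (p (k + 2)) (q (k + 1))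
    simp only [show k + 1 + 1 = k + 2 by omega, show k + 2 + 1 = k + 3 by omega,
      show k + 2 - 1 = k + 1 by omega]
    linarith

/-- The operator `ω_m` moves the first weight of a triangle to the last place. -/
theorem sum_row_sub_sum_omegaOp (X : ℕ → ℕ → ℤ) {k m : ℕ} (hk : k ≤ m) :
    ∑ j ∈ Finset.Icc 1 (k + 1), X (k + 1) j - ∑ j ∈ Finset.Icc 1 k, omegaOp m X k j = X 1 1 := by
  induction k with
  | zero => simp
  | succ k ih =>
    have := ih (by omega)
    rw [Finset.sum_congr rfl fun j _ => omegaOp_apply X hk j,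
      sum_reflection (X (k + 2)) (omegaOp m X k) (X (k + 1)) k]
    linarith

theorem sum_schutzenberger_sub (X : ℕ → ℕ → ℤ) {n : ℕ} (hn : 2 ≤ n) :
    ∑ i ∈ Finset.Icc 1 n, schutzenberger n X n i -
      ∑ i ∈ Finset.Icc 1 (n - 1), schutzenberger n X (n - 1) i = X 1 1 := by
  obtain ⟨m, rfl⟩ : ∃ m, n = m + 2 := ⟨n - 2, by omega⟩
  have h := sum_row_sub_sum_omegaOp X (le_refl (m + 1))
  simp only [schutzenberger, show m + 2 - 1 = m + 1 by omega]
  rw [omegaProd_of_lt X (by omega), omegaProd, omegaProd_of_lt _ (by omega)]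
  exact h

/-! ### The invariant of the Gog algorithm -/

/-- The invariant of the algorithm: `(u, v)` are the two rightmost diagonals of a
Gelfand-Tsetlin triangle of size `m + 1` with other entries `n - m`. -/
structure GogStateInvariant (n m : ℕ) (β : ℤ) (u v : ℕ → ℤ) : Prop where
  top_le : u 0 ≤ n
  le_last : (n : ℤ) - m ≤ u m
  u_anti : ∀ i, i < m → u (i + 1) ≤ u i
  v_anti : ∀ i, 1 ≤ i → i < m → v (i + 1) ≤ v i
  le_v : ∀ i, 1 ≤ i → i ≤ m → (n : ℤ) - m ≤ v i
  v_le_u : ∀ i, 1 ≤ i → i ≤ m → v i ≤ u i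
  v_large : ∀ i, 1 ≤ i → i ≤ m → v i = (n : ℤ) - m ∨ β - (m - i) ≤ v i
  excess : ∀ p q, 1 ≤ p → p < q → q ≤ m → u 0 - u p + v p - v q ≤ (q : ℤ) - 2
  excess_last : ∀ p, 1 ≤ p → p ≤ m → u 0 - u p + v p - ((n : ℤ) - m) ≤ (m : ℤ) - 1

theorem GogStateInvariant.u_le {n m : ℕ} {β : ℤ} {u v : ℕ → ℤ}
    (h : GogStateInvariant n m β u v) {i j : ℕ} (hij : i ≤ j) (hj : j ≤ m) : u j ≤ u i := by
  induction j, hij using Nat.le_induction with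
  | base => exact le_rfl
  | succ j hij ih => exact (h.u_anti j (by omega)).trans (ih (by omega))

theorem GogStateInvariant.v_le {n m : ℕ} {β : ℤ} {u v : ℕ → ℤ}
    (h : GogStateInvariant n m β u v) {i j : ℕ} (hi : 1 ≤ i) (hij : i ≤ j) (hj : j ≤ m) :
    v j ≤ v i := by
  induction j, hij using Nat.le_induction with
  | base => exact le_rfl
  | succ j hij ih => exact (h.v_anti j (by omega) (by omega)).trans (ih (by omega))

theorem isGelfandTsetlin_triangleOf {m : ℕ} {c : ℤ} {u v : ℕ → ℤ} (hc : 1 ≤ c)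
    (hu : ∀ i, i + 1 < m → u (i + 1) ≤ u i) (hv : ∀ i, 1 ≤ i → i + 1 < m → v (i + 1) ≤ v i)
    (hcv : ∀ i, 1 ≤ i → i < m → c ≤ v i) (hvu : ∀ i, 1 ≤ i → i < m → v i ≤ u i)
    (hcu : 1 ≤ m → c ≤ u (m - 1)) : IsGelfandTsetlin m (triangleOf m c u v) := by
  have key : ∀ i, i < m → c ≤ u i := by
    intro i hi
    by_cases h : i = m - 1
    · exact h ▸ hcu (by omega)
    · exact (hcv (i + 1) (by omega) (by omega)).trans
        ((hvu (i + 1) (by omega) (by omega)).trans (hu i (by omega)))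
  constructor
  · intro i j hj hji hi
    unfold triangleOf
    split_ifs with h1 h2
    · exact hc.trans (key _ (by omega))
    · exact hc.trans (hcv _ (by omega) (by omega))
    · exact hc
  · intro i j hj hji hi
    unfold triangleOf
    constructor
    · by_cases h1 : i = j
      · subst h1
        simpa using hvu (m - i) (by omega) (by omega)
      · by_cases h2 : i = j + 1
        · subst h2
          rw [if_neg (by omega), if_neg (by omega), if_neg (by omega), if_pos rfl]
          exact hcv (m - j) (by omega) (by omega)
        · rw [if_neg (by omega), if_neg (by omega), if_neg h1, if_neg h2]
    · by_cases h1 : i = j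
      · subst h1
        have := hu (m - (i + 1)) (by omega)
        rw [show m - (i + 1) + 1 = m - i by omega] at this
        simpa using this
      · by_cases h2 : i = j + 1
        · subst h2
          have := hv (m - (j + 1)) (by omega) (by omega)
          rw [show m - (j + 1) + 1 = m - j by omega] at this
          simpa using this
        · rw [if_neg h1, if_neg h2, if_neg (by omega), if_neg (by omega)]

theorem IsGelfandTsetlin.le_of_triangleOf {m : ℕ} {c : ℤ} {u v : ℕ → ℤ}
    (h : IsGelfandTsetlin m (triangleOf m c u v)) :
    (∀ i, 1 ≤ i → i < m → v i ≤ u i) ∧ ∀ i, 1 ≤ i → i + 1 < m → v (i + 1) ≤ v i := by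
  constructor
  · intro i hi him
    have := (h.2 (m - i) (m - i) (by omega) le_rfl (by omega)).1
    simpa [triangleOf, show m - (m - i) = i by omega] using this
  · intro i hi him
    have := (h.2 (m - i) (m - (i + 1)) (by omega) (by omega) (by omega)).2
    rw [triangleOf, triangleOf, if_neg (by omega), if_pos (by omega), if_neg (by omega),
      if_pos (by omega), show m - (m - (i + 1)) = i + 1 by omega,
      show m - (m - (i + 1) + 1) = i by omega] at this
    exact this

theorem gogStateInvariant_zero (n : ℕ) (β : ℤ) (v : ℕ → ℤ) :
    GogStateInvariant n 0 β (fun _ => (n : ℤ)) v := by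
  constructor <;> intros <;> omega

/-- Lowering the old entries of `v` by `1` and those of `u` by `ε ∈ {0, 1}`. -/
theorem GogStateInvariant.lower {n m : ℕ} {β a b ε : ℤ} {u v : ℕ → ℤ}
    (h : GogStateInvariant n m β u v) (hε : 0 ≤ ε) (hε1 : ε ≤ 1)
    (hau : a ≤ u m - ε) (hca : (n : ℤ) - (m + 1 : ℕ) ≤ a) (hbβ : 1 ≤ m → b ≤ β)
    (hεa : (n : ℤ) - (m + 1 : ℕ) + 1 ≤ a + ε) :
    GogStateInvariant n (m + 1) b (fun i => if i = m + 1 then a else u i - ε)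
      (fun i => if i = m + 1 then (n : ℤ) - (m + 1 : ℕ) else v i - 1) := by
  have htop := h.top_le
  push_cast at *
  constructor
  · grind
  · grind
  · intro i hi
    have := h.u_anti i
    grind
  · intro i hi him
    have := h.v_anti i hi
    have := h.le_v i hi (by omega)
    grind
  · intro i hi him
    have := h.le_v i hi
    grind
  · intro i hi him
    have := h.v_le_u i hi
    grind
  · intro i hi him
    have := h.v_large i hi
    have := hbβ
    grind
  -- For `q = m + 1` this is the old `excess_last`, which is `excess` with the background value `n -
  -- m` in place of v_{m+1}.
  · intro p q hp hpq hq
    have h1 := h.excess p q hp hpq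
    have h2 := h.excess_last p hp
    grind
  · intro p hp hpm
    have h2 := h.excess_last p hp
    grind

/-- Keeping `v`, with `b` appended to it. -/
theorem GogStateInvariant.append {n m : ℕ} {β a b ε : ℤ} {u v : ℕ → ℤ}
    (h : GogStateInvariant n m β u v) (hε : 0 ≤ ε)
    (hau : a ≤ u m - ε) (hcb : (n : ℤ) - (m + 1 : ℕ) < b) (hba : b ≤ a)
    (hvu : ∀ i, 1 ≤ i → i ≤ m → v i ≤ u i - ε) (hbv : 1 ≤ m → b ≤ v m)
    (hεa : b + 1 ≤ a + ε) :
    GogStateInvariant n (m + 1) b (fun i => if i = m + 1 then a else u i - ε)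
      (fun i => if i = m + 1 then b else v i) := by
  have htop := h.top_le
  push_cast at *
  constructor
  · grind
  · grind
  · intro i hi
    have := h.u_anti i
    grind
  · intro i hi him
    have := h.v_anti i hi
    grind
  · intro i hi him
    have := h.le_v i hi
    grind
  · intro i hi him
    have := hvu i hi
    grind
  · intro i hi him
    have := h.v_le (i := i) (j := m) hi
    grind
  · intro p q hp hpq hq
    have h1 := h.excess p q hp hpq
    have h2 := h.excess_last p hp
    grind
  -- For `p ≤ m` both the background and the bound shift by 1. For `p = m + 1` only u_0 ≤ n and
  -- `hεa` are needed.
  · intro p hp hpm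
    have h2 := h.excess_last p hp
    grind

/-- Moving `b` upwards along `v`, lowered by `1` at each of its `l` steps. -/
theorem GogStateInvariant.insert {n m : ℕ} {β a b : ℤ} {u v : ℕ → ℤ} {l : ℕ}
    (h : GogStateInvariant n m β u v)
    (hau : a ≤ u m) (hba : b < a) (hbβ : b ≤ β)
    (hl : 1 ≤ l) (hlm : l ≤ m) (hvl : v (m + 1 - l) ≤ b - l)
    (hlmax : ∀ i, l < i → i ≤ m → b - i < v (m + 1 - i)) :
    GogStateInvariant n (m + 1) b (fun i => if i = m + 1 then a else u i)
      (fun i => if m + 1 - l < i then (n : ℤ) - (m + 1 : ℕ)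
        else if i = m + 1 - l then b - l else if i = m + 1 then b else v i) := by
  obtain ⟨r, hr⟩ : ∃ r, r = m + 1 - l := ⟨_, rfl⟩
  rw [← hr] at hvl ⊢
  have hlr : (l : ℤ) = m + 1 - r := by omega
  have hr1 : 1 ≤ r := by omega
  have hrm : r ≤ m := by omega
  have hlmax' : ∀ i, 1 ≤ i → i < r → b - (m + 1 - i) < v i := by
    intro i hi hir
    have := hlmax (m + 1 - i) (by omega) (by omega)
    rw [show m + 1 - (m + 1 - i) = i by omega] at this
    push_cast [show i ≤ m + 1 by omega] at this
    exact this
  -- The landing place holds the background value: otherwise `v_large` gives v_r ≥ β - (m - r) > b -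
  -- l, because b ≤ β. Hence the insertion does not decrease v_r, and only background entries are
  -- overwritten.
  have hvr : v r = (n : ℤ) - m := by
    have := h.v_large r hr1 hrm
    omega
  have htop := h.top_le
  have hua : ∀ i, i ≤ m → a ≤ u i := fun i hi => hau.trans (h.u_le hi le_rfl)
  clear hlmax hr
  push_cast at *
  constructor
  · grind
  · grind
  · intro i hi
    have := h.u_anti i
    grind
  · intro i hi him
    have := h.v_anti i hi
    have := hlmax' i hi
    have := h.le_v i hi
    grind
  · intro i hi him
    have := h.le_v i hi
    grind
  · intro i hi him
    have := h.v_le_u i hi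
    have := hua i
    grind
  · intro i hi him
    have := hlmax' i hi
    grind
  -- For `p < r < q` the old inequality for (p, r) suffices, the background dropping by 1. For `p ≥
  -- r`, use u_0 ≤ n and b < a ≤ u_p (p ≤ m), with b - l ≥ n - m when p > r.
  · intro p q hp hpq hq
    have h1 := h.excess p q hp hpq
    have h2 := h.excess p r hp
    have := hua p
    grind
  · intro p hp hpm
    have h2 := h.excess p r hp
    have := hua p
    grind

/-- All cases are instances of `lower`, `append` and `insert`. Where u is lowered one has a = b, and
the strict inequality b < u_m leaves room for the subtraction. -/
theorem GogStateInvariant.gogStep {n m : ℕ} {β a b : ℤ} {p : (ℕ → ℤ) × (ℕ → ℤ)}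
    (h : GogStateInvariant n m β p.1 p.2) (hau : a ≤ p.1 m) (hbu : b < p.1 m)
    (hcb : (n : ℤ) - (m + 1 : ℕ) ≤ b) (hba : b ≤ a) (hbβ : 1 ≤ m → b ≤ β) :
    GogStateInvariant n (m + 1) b (gogStep n (m + 1) a b p).1 (gogStep n (m + 1) a b p).2 ∧
      (gogStep n (m + 1) a b p).1 (m + 1) = a := by
  obtain ⟨u, v⟩ := p
  simp only at h hau hbu
  unfold _root_.gogStep
  simp only
  rw [if_neg (show m + 1 - 1 ≠ m + 1 by omega), Nat.add_sub_cancel]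
  split_ifs with h1 h2 h3 h4 h5
  · exact ⟨h.lower (ε := 1) (by simp) (by simp) (by omega) (by omega) hbβ (by omega), by simp⟩
  · have := h.lower (ε := 0) (a := a) le_rfl (by simp) (by omega) (by omega) hbβ (by omega)
    simp only [sub_zero] at this
    exact ⟨this, by simp⟩
  · obtain ⟨hvu, hv⟩ := h4.le_of_triangleOf
    refine ⟨h.append (ε := 1) (by simp) (by omega) (by omega) hba ?_ ?_ (by omega), by simp⟩
    · intro i hi him
      have := hvu i hi (by omega)
      rwa [if_neg (by omega), if_neg (by omega)] at this
    · intro hm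
      have := hv m hm (by omega)
      rwa [if_pos rfl, if_neg (by omega)] at this
  · exact ⟨h.lower (ε := 1) (by simp) (by simp) (by omega) (by omega) hbβ (by omega), by simp⟩
  · have := h.append (ε := 0) (a := a) (b := b) le_rfl (by omega) (by omega) hba
      (by simpa using h.v_le_u) (fun _ => h5) (by omega)
    simp only [sub_zero] at this
    exact ⟨this, by simp⟩
  -- For `m = 0` the comparison with the meaningless v_0 is harmless: n - 1 < b < a ≤ u_0 ≤ n is
  -- impossible.
  · have hm : 1 ≤ m := by
      rcases Nat.eq_zero_or_pos m with rfl | hm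
      · have := h.top_le
        push_cast at *
        omega
      · exact hm
    rw [not_le] at h5
    simp only [if_true]
    set P : ℕ → Prop := fun i => (if m + 1 - i = m + 1 then b else v (m + 1 - i)) ≤ b - i
    have hP : ∀ i, 1 ≤ i → i ≤ m → (P i ↔ v (m + 1 - i) ≤ b - i) := by
      intro i hi him
      show (if m + 1 - i = m + 1 then b else v (m + 1 - i)) ≤ b - i ↔ _
      rw [if_neg (by omega)]
    have hP1 : P 1 := by
      rw [hP 1 le_rfl hm, Nat.add_sub_cancel]
      push_cast
      omega
    have hl : 1 ≤ Nat.findGreatest P m := Nat.le_findGreatest hm hP1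
    have hlm : Nat.findGreatest P m ≤ m := Nat.findGreatest_le m
    have hspec : P (Nat.findGreatest P m) := Nat.findGreatest_spec hm hP1
    refine ⟨h.insert hau (by omega) (hbβ hm) hl hlm ((hP _ hl hlm).1 hspec) ?_,
      by simp⟩
    intro i hi him
    exact not_le.1 fun hle =>
      Nat.findGreatest_is_greatest hi him ((hP i (by omega) him).2 hle)

/-! ### From the algorithm to the Magog trapezoid -/

/-- β is the last value b appended. The b's weakly decrease by interlacing, and b < u_m is
strictness of a row of X. -/
theorem IsGogTrapezoid.gogStateInvariant {n : ℕ} {X : ℕ → ℕ → ℤ} (h : IsGogTrapezoid n 2 X)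
    {m : ℕ} (hm : m + 1 ≤ n) :
    GogStateInvariant n m (if m = 0 then 0 else X (n - m + 1) (n - m)) (gogState n X m).1
      (gogState n X m).2 ∧ (gogState n X m).1 m = X (n - m) (n - m) := by
  obtain ⟨hn, hX, hT⟩ := h
  induction m with
  | zero => exact ⟨gogStateInvariant_zero n _ _, (hX.2.2 n (by omega) le_rfl).symm⟩
  | succ m ih =>
    obtain ⟨ih1, ih2⟩ := ih (by omega)
    rw [if_neg (by omega)]
    obtain ⟨r, hr⟩ : ∃ r, n = r + (m + 1) := ⟨n - (m + 1), by omega⟩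
    have e1 : n - (m + 1) = r := by omega
    have e2 : n - m = r + 1 := by omega
    have hle := hX.1.2 r r (by omega) le_rfl (by omega)
    rw [gogState, e1]
    rw [e2] at ih1 ih2
    refine ih1.gogStep ?_ ?_ ?_ hle.1 ?_
    · rw [ih2]
      exact hle.2
    · rw [ih2]
      exact hX.strict (by omega) (by omega) (by omega)
    · have hc : (n : ℤ) - (m + 1 : ℕ) = r := by omega
      rw [hc]
      -- For `m = 0` the value b lies in the fixed row `n`; later it is bounded below by the
      -- trapezoid entry under it, in row `r + 2`.
      rcases Nat.eq_zero_or_pos m with rfl | hm0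
      · rw [← hX.2.2 r (by omega) (by omega), hr]
      · rw [← hT (r + 2) r (by omega) le_rfl (by omega)]
        exact (hX.1.2 (r + 1) r (by omega) (by omega) (by omega)).1
    · intro hm0
      rw [if_neg (by omega)]
      exact (hX.1.2 (r + 1) r (by omega) (by omega) (by omega)).2

theorem IsGogTrapezoid.isGelfandTsetlin_gogToGOGAm {n : ℕ} {X : ℕ → ℕ → ℤ}
    (h : IsGogTrapezoid n 2 X) : IsGelfandTsetlin n (gogToGOGAm n X) := by
  have hn := h.1
  have inv := (h.gogStateInvariant (m := n - 1) (by omega)).1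
  have hc : (n : ℤ) - (n - 1 : ℕ) = 1 := by omega
  exact isGelfandTsetlin_triangleOf le_rfl (fun i hi => inv.u_anti i (by omega))
    (fun i h1 hi => inv.v_anti i h1 (by omega)) (fun i h1 hi => hc ▸ inv.le_v i h1 (by omega))
    (fun i h1 hi => inv.v_le_u i h1 (by omega)) (fun _ => hc ▸ inv.le_last)

theorem hasTwoDiagonals_gogToGOGAm (n : ℕ) (X : ℕ → ℕ → ℤ) :
    HasTwoDiagonals n (gogToGOGAm n X) := by
  intro i j hj hji hi
  rw [gogToGOGAm, triangleOf, if_neg (by omega), if_neg (by omega)]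

theorem IsGogTrapezoid.excessBounded_gogToGOGAm {n : ℕ} {X : ℕ → ℕ → ℤ}
    (h : IsGogTrapezoid n 2 X) : ExcessBounded n (gogToGOGAm n X) := by
  have hn := h.1
  have inv := (h.gogStateInvariant (m := n - 1) (by omega)).1
  have hc : (n : ℤ) - (n - 1 : ℕ) = 1 := by omega
  have hA : ∀ i, gogToGOGAm n X i i = (gogState n X (n - 1)).1 (n - i) := by
    intro i
    rw [gogToGOGAm, triangleOf, if_pos rfl]
  have hB : ∀ i, 1 < i → i ≤ n →
      secondDiagonal (gogToGOGAm n X) i = (gogState n X (n - 1)).2 (n + 1 - i) := by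
    intro i hi hin
    rw [secondDiagonal, if_neg (by omega), gogToGOGAm, triangleOf, if_neg (by omega),
      if_pos (by omega), show n - (i - 1) = n + 1 - i by omega]
  constructor
  · rw [hA, Nat.sub_self]
    exact inv.top_le
  · intro m t hm hmt ht
    rw [hA, hA, hB t (by omega) ht, Nat.sub_self, show n - (t - 1) = n + 1 - t by omega]
    -- The case `m = 1` is `excess_last`, since B_1 = 1 is the final background value.
    obtain rfl | hm1 := Nat.eq_or_lt_of_le hm
    · have := inv.excess_last (n + 1 - t) (by omega) (by omega)
      simp only [secondDiagonal, if_true]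
      omega
    · rw [hB m hm1 (by omega)]
      have := inv.excess (n + 1 - t) (n + 1 - m) (by omega) (by omega) (by omega)
      omega

theorem mainTheorem6 :
    (∀ (n : ℕ), 1 ≤ n → ∀ X : ℕ → ℕ → ℤ, IsGog n X →
      (∃ M : Matrix (Fin n) (Fin n) ℤ, IsAlternatingSignMatrix M ∧ IsGogTriangleOf M X) ∧
      ∀ M : Matrix (Fin n) (Fin n) ℤ, IsAlternatingSignMatrix M → IsGogTriangleOf M X →
        ∀ r c : Fin n, (r : ℕ) + 1 = n →
          M r c = if X 1 1 = ((c : ℕ) : ℤ) + 1 then 1 else 0) ∧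
    (∀ (n : ℕ) (X : ℕ → ℕ → ℤ), IsGogTrapezoid n 2 X →
      IsGOGAmTrapezoid n 2 (gogToGOGAm n X) ∧
      gogToGOGAm n X 1 1 = X 1 1 ∧
      IsMagogTrapezoid n 2 (gogToMagog n X) ∧
      X 1 1 = ∑ i ∈ Finset.Icc 1 n, gogToMagog n X n i
        - ∑ i ∈ Finset.Icc 1 (n - 1), gogToMagog n X (n - 1) i) := by
  refine ⟨fun n _ X hX => ⟨⟨gogMatrix n X, hX.isAlternatingSignMatrix_gogMatrix,
    hX.isGogTriangleOf_gogMatrix⟩, fun M hM hMX r c hr => hMX.bottom_row hM hr c⟩, ?_⟩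
  intro n X h
  have hn := h.1
  have hGT := h.isGelfandTsetlin_gogToGOGAm
  have hD := hasTwoDiagonals_gogToGOGAm n X
  have hE := h.excessBounded_gogToGOGAm
  have hMagog : IsMagog n (schutzenberger n (gogToGOGAm n X)) := by
    refine ⟨hGT.omegaProd (by omega), fun i hi hin => ?_⟩
    obtain ⟨m, rfl⟩ : ∃ m, n = m + 1 := ⟨n - 1, by omega⟩
    exact hE.omegaProd_le hGT hD hi hin
  have h11 : gogToGOGAm n X 1 1 = X 1 1 := by
    have := (h.gogStateInvariant (m := n - 1) (by omega)).2
    rw [show n - (n - 1) = 1 by omega] at this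
    rw [gogToGOGAm, triangleOf, if_pos rfl, this]
  exact ⟨⟨hn, hGT, hMagog, hD⟩, h11, ⟨hn, hMagog, hD.omegaProd hGT (by omega)⟩,
    by rw [gogToMagog, sum_schutzenberger_sub _ hn, h11]⟩
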